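/- Let $\mathbb F$ be the field with two elements and let $m,r_1,r_2$ be such that $n=2^m-1=r_1r_2$ with $r_1,r_2>1$ odd and coprime. Let $G$ be the field with $2^m$ elements, $\alpha\in G$ a primitive $n$-th root of unity, and $T:\mathbb Z_n\to\mathbb Z_{r_1}\times\mathbb Z_{r_2}$ an arbitrary isomorphism of groups. For $0<\rho<m$ the Reed-Muller code $R(\rho,m)\subseteq\mathbb F G$ (the group algebra of the additive group of $G$) is the code with defining set $\{s\mid 0\le s<2^m-1,\ \mathrm{wt}(s)<m-\rho\}$, where $\mathrm{wt}(s)$ is the number of ones in the binary expansion of $s$; that is, the set of all $\sum_{g\in G}a_gX^g$ with $\sum_g a_g g^s=0$ for all these $s$ (with $0^0=1$). The punctured code $R^*(\rho,m)\subseteq\mathbb F[X]/(X^n-1)$ is obtained by deleting the coordinate $g=0$ and indexing the coordinate $\alpha^i$ by $i\in\mathbb Z_n$. The defining set with respect to $\alpha$ of a code $\mathcal C^*\subseteq \mathbb F[X]/(X^n-1)$ is the set of $s\in\mathbb Z_n$ with $P(\alpha^s)=0$ for all $P\in\mathcal C^*$; the defining set of an ideal $\mathcal C$ of $\mathbb A(r_1,r_2)=\mathbb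 F[X_1,X_2]/(X_1^{r_1}-1,X_2^{r_2}-1)$ with respect to primitive $r_i$-th roots of unity $\beta_i$ is the set of $(s_1,s_2)\in\mathbb Z_{r_1}\times\mathbb Z_{r_2}$ with $P(\beta_1^{s_1},\beta_2^{s_2})=0$ for all $P\in\mathcal C$. An information set of a code $\mathcal C$ of dimension $k$ is a set of $k$ positions such that $\mathcal C$ restricts onto the full space $\mathbb F^k$ on these positions; a set of check positions is the complement of an information set. For a set $D\subseteq\mathbb Z_{r_1}\times\mathbb Z_{r_2}$ closed under multiplication by $2$, a set $\overline D\subseteq D$ of restricted representatives contains exactly one element of each orbit $\{(2^ie_1,2^ie_2)\mid i\ge 0\}$ in $D$, and its first projection $\overline D_1$ contains exactly one element of each $2$-cyclotomic coset modulo $r_1$ in the first projection of $D$. Put $m(e_1)=|\{2^ie_1\mid i\ge0\}|$, $m(e_1,e_2)=|\{2^{m(e_1)i}e_2\mid i\ge0\}|$ and $M(e_1)=\sum_{(e_1,e_2)\in\overline D}m(e_1,e_2)$; let $f_1>\dots>f_s$ be the distinct values of $M$ on $\overline D_1$, $f_{s+1}=0$, and $g_j=\sum_{M(e_1)\ge f_j}m(e_1)$.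 For an abelian code $\mathcal C$ with defining set $D$ let $\Gamma(\mathcal C)$ be the set of $(i_1,i_2)$ such that $f_{j+1}\le i_2<f_j$ and $0\le i_1<g_j$ for some $1\le j\le s$. Here and below residues are written as canonical representatives. **Theorem.** Let $a=\mathrm{Ord}_{r_1}(2)$ be the order of $2$ modulo $r_1$. Then $a$ divides $m$. Put $$\Gamma=\left\{(i_1,i_2)\in\mathbb Z_{r_1}\times\mathbb Z_{r_2}\ \middle|\ 0\le i_1<a,\ 0\le i_2<\tfrac ma\right\}.$$ 1. Let $\mathcal D^*\subseteq\mathbb Z_n$ be the defining set of $R^*(m-2,m)$ with respect to $\alpha$. For all primitive $r_1$-th and $r_2$-th roots of unity $\beta_1,\beta_2\in G$ and every ideal $\mathcal C$ of $\mathbb A(r_1,r_2)$ whose defining set with respect to $(\beta_1,\beta_2)$ is $T(\mathcal D^*)$, a set of restricted representatives exists and, for every choice of it, $\Gamma(\mathcal C)=\Gamma$. 2. $T^{-1}(\Gamma)$ is a set of check positions for $R^*(m-2,m)$. 3. $\{0\}\cup\{\alpha^i\mid i\in T^{-1}(\Gamma)\}$ is an information set for $R(1,m)$. 4. $\{\alpha^i\mid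 i\notin T^{-1}(\Gamma)\}$ is an information set for $R(m-2,m)$. -/

import Mathlib

namespace RMCode

/-- The binary group algebra `𝔽₂[G]` of an additive abelian group `G`, with elements
`∑ a_g X^g`; the coefficient `a_g` of `x` is `x.coeff g`. With `G = ZMod n` this is
`𝔽₂[X] / (X ^ n - 1)`, and with `G = ZMod r₁ × ZMod r₂` it is
`𝔽₂[X₁, X₂] / (X₁ ^ r₁ - 1, X₂ ^ r₂ - 1)`. -/
abbrev BinAlg (G : Type*) : Type _ := AddMonoidAlgebra (ZMod 2) G

/-! ### Information sets and sets of check positions -/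

/-- `I` is an information set for the linear code `C`: its size is the dimension of `C`, and the
restriction of `C` to the positions in `I` is the whole space of binary vectors indexed by `I`. -/
def IsInformationSet {G : Type*} (C : Submodule (ZMod 2) (BinAlg G)) (I : Set G) : Prop :=
  I.ncard = Module.finrank (ZMod 2) C ∧
    ∀ v : I → ZMod 2, ∃ x ∈ C, ∀ i : I, x.coeff (i : G) = v i

/-- A set of check positions is the complement of an information set. -/
def IsCheckPositions {G : Type*} (C : Submodule (ZMod 2) (BinAlg G)) (I : Set G) : Prop :=
  IsInformationSet C Iᶜ

/-! ### Reed-Muller codes in the group algebra of the field with `2 ^ m` elements -/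

/-- The `2`-weight: the number of ones in the binary expansion of `k`. -/
def wt (k : ℕ) : ℕ := (Nat.digits 2 k).sum

section ReedMuller

variable {K : Type*} [Field K] [Algebra (ZMod 2) K]

/-- `φ_s (∑ a_g X^g) = ∑ a_g g^s`, with `0 ^ 0 = 1`. -/
noncomputable def phi (s : ℕ) (x : BinAlg K) : K :=
  Finsupp.linearCombination (ZMod 2) (fun g : K => g ^ s) x.coeff

/-- The defining set of the Reed-Muller code of order `ρ` and length `2 ^ m` (`0 < ρ < m`). -/
def reedMullerDefiningSet (ρ m : ℕ) : Set ℕ := {i | i < 2 ^ m - 1 ∧ wt i < m - ρ}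

variable (K) in
/-- The Reed-Muller code `R(ρ, m)` (`0 < ρ < m`) in the group algebra of the additive group of
the field `K` with `2 ^ m` elements: the code with defining set `reedMullerDefiningSet ρ m`,
that is, the code of all `x` such that `φ_s x = 0` for all `s` in that set. -/
noncomputable def reedMuller (ρ m : ℕ) : Submodule (ZMod 2) (BinAlg K) where
  carrier := {x | ∀ s ∈ reedMullerDefiningSet ρ m, phi s x = 0}
  zero_mem' := by
    intro s _
    simp [phi]
  add_mem' := by
    intro x y hx hy s hs
    have h1 := hx s hs
    have h2 := hy s hs
    simp only [phi] at h1 h2 ⊢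
    rw [AddMonoidAlgebra.coeff_add, map_add, h1, h2, add_zero]
  smul_mem' := by
    intro c x hx s hs
    have h1 := hx s hs
    simp only [phi] at h1 ⊢
    rw [AddMonoidAlgebra.coeff_smul, map_smul, h1, smul_zero]

/-- The punctured code `R*(ρ, m)` at the position `X^0`, as a code of length `n = 2 ^ m - 1` in
`𝔽₂[X] / (X ^ n - 1)`: the coordinate `i : ZMod n` is the coordinate `α ^ i` of `R(ρ, m)`. -/
noncomputable def puncturedReedMuller (α : K) (ρ m : ℕ) :
    Submodule (ZMod 2) (BinAlg (ZMod (2 ^ m - 1))) where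
  carrier := {c | ∃ x ∈ reedMuller K ρ m,
    ∀ i : ZMod (2 ^ m - 1), c.coeff i = x.coeff (α ^ i.val)}
  zero_mem' := ⟨0, Submodule.zero_mem _, fun i => by simp⟩
  add_mem' := by
    rintro c d ⟨x, hx, hc⟩ ⟨y, hy, hd⟩
    exact ⟨x + y, Submodule.add_mem _ hx hy, fun i => by simp [hc, hd]⟩
  smul_mem' := by
    rintro b c ⟨x, hx, hc⟩
    exact ⟨b • x, Submodule.smul_mem _ b hx, fun i => by simp [hc]⟩

/-! ### Defining sets of cyclic codes and of two-dimensional abelian codes -/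

/-- The defining set, with respect to the `n`-th root of unity `α`, of a binary code of
length `n`: all `s` such that `P (α ^ s) = 0` for every codeword `P`. -/
def cyclicDefiningSet {n : ℕ} (α : K) (C : Submodule (ZMod 2) (BinAlg (ZMod n))) :
    Set (ZMod n) :=
  {s | ∀ P ∈ C,
    Finsupp.linearCombination (ZMod 2) (fun i : ZMod n => (α ^ s.val) ^ i.val) P.coeff = 0}

/-- The defining set of an abelian code (an ideal) in `𝔽₂[X₁, X₂] / (X₁ ^ r₁ - 1, X₂ ^ r₂ - 1)`
with respect to the roots of unity `β₁`, `β₂`: all `(s₁, s₂)` such that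
`P (β₁ ^ s₁, β₂ ^ s₂) = 0` for every codeword `P`. -/
def abelianDefiningSet {r₁ r₂ : ℕ} (β₁ β₂ : K) (C : Ideal (BinAlg (ZMod r₁ × ZMod r₂))) :
    Set (ZMod r₁ × ZMod r₂) :=
  {s | ∀ P ∈ C,
    Finsupp.linearCombination (ZMod 2)
      (fun i : ZMod r₁ × ZMod r₂ => (β₁ ^ s.1.val) ^ i.1.val * (β₂ ^ s.2.val) ^ i.2.val)
      P.coeff = 0}

end ReedMuller

/-! ### The set `Γ` of a two-dimensional abelian code -/

/-- The `2 ^ γ`-cyclotomic coset of `a` modulo `r`. -/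
def cyclotomicCoset (γ r : ℕ) (a : ZMod r) : Set (ZMod r) :=
  Set.range fun i : ℕ => a * 2 ^ (γ * i)

/-- The `2`-orbit of a pair modulo `(r₁, r₂)`. -/
def twoOrbit {r₁ r₂ : ℕ} (e : ZMod r₁ × ZMod r₂) : Set (ZMod r₁ × ZMod r₂) :=
  Set.range fun i : ℕ => (e.1 * 2 ^ i, e.2 * 2 ^ i)

/-- `m(e₁) = |C_{r₁}(e₁)|`. -/
noncomputable def mFirst {r₁ : ℕ} (e₁ : ZMod r₁) : ℕ := (cyclotomicCoset 1 r₁ e₁).ncard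

/-- `m(e₁, e₂)`, the size of the `2 ^ m(e₁)`-cyclotomic coset of `e₂` modulo `r₂`. -/
noncomputable def mPair {r₁ r₂ : ℕ} (e : ZMod r₁ × ZMod r₂) : ℕ :=
  (cyclotomicCoset (mFirst e.1) r₂ e.2).ncard

/-- `R` is a set of restricted representatives of the `2`-orbits in `D`: it contains exactly one
element of each orbit in `D`, and its first projection contains exactly one element of each
`2`-cyclotomic coset modulo `r₁` in the first projection of `D`. -/
def IsRestrictedRepresentatives {r₁ r₂ : ℕ} (D : Set (ZMod r₁ × ZMod r₂))
    (R : Finset (ZMod r₁ × ZMod r₂)) : Prop :=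
  (R : Set (ZMod r₁ × ZMod r₂)) ⊆ D ∧
    (∀ e ∈ D, ∃! d, d ∈ R ∧ e ∈ twoOrbit d) ∧
    ∀ e₁ ∈ Prod.fst '' D, ∃! d₁, d₁ ∈ R.image Prod.fst ∧ e₁ ∈ cyclotomicCoset 1 r₁ d₁

/-- `M(e₁)`, the sum of `m(e₁, e₂)` over all `e₂` with `(e₁, e₂) ∈ R`. -/
noncomputable def MSum {r₁ r₂ : ℕ} (R : Finset (ZMod r₁ × ZMod r₂)) (e₁ : ZMod r₁) : ℕ :=
  ∑ e ∈ R with e.1 = e₁, mPair e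

/-- The values `f₁ > f₂ > ⋯ > f_s > 0` of `M` in decreasing order, followed by zeros
(a maximum over the empty set is `0`); here `fSeq R j` is `f_{j+1}`. -/
noncomputable def fSeq {r₁ r₂ : ℕ} (R : Finset (ZMod r₁ × ZMod r₂)) : ℕ → ℕ
  | 0 => ((R.image Prod.fst).image (MSum R)).sup id
  | j + 1 => (((R.image Prod.fst).image (MSum R)).filter (· < fSeq R j)).sup id

/-- The sum of `m(e₁)` over all `e₁` in the first projection of `R` with `M(e₁) ≥ f_{j+1}`;
here `gSeq R j` is `g_{j+1}`. -/
noncomputable def gSeq {r₁ r₂ : ℕ} (R : Finset (ZMod r₁ × ZMod r₂)) (j : ℕ) : ℕ :=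
  ∑ e₁ ∈ R.image Prod.fst with fSeq R j ≤ MSum R e₁, mFirst e₁

/-- The set `Γ` computed from a set `R` of restricted representatives of the defining set of a
two-dimensional abelian code: all `(i₁, i₂)` such that `f_{j+1} ≤ i₂ < f_j` and `0 ≤ i₁ < g_j`
for some `j ≥ 1` (indices shifted by one in the code; the zeros in `fSeq` contribute nothing). -/
def Gam {r₁ r₂ : ℕ} (R : Finset (ZMod r₁ × ZMod r₂)) : Set (ZMod r₁ × ZMod r₂) :=
  {i | ∃ j : ℕ, fSeq R (j + 1) ≤ i.2.val ∧ i.2.val < fSeq R j ∧ i.1.val < gSeq R j}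

/-- The rectangle `0 ≤ i₁ < a`, `0 ≤ i₂ < b` in `ZMod r₁ × ZMod r₂`, with residues written as
canonical representatives. -/
def rectangle (r₁ r₂ a b : ℕ) : Set (ZMod r₁ × ZMod r₂) :=
  {i | i.1.val < a ∧ i.2.val < b}

end RMCode

/-!
The code `R(m - 2, m)` is the extended Hamming code: a binary word `x` on `K` belongs to it exactly
when `∑ x_g = 0` and `∑ x_g g = 0`, since `φ_{2 ^ j}` is the `2 ^ j`-th power of `φ_1`. Deleting the
parity bit at `0` leaves the Hamming code, given by `∑ c_i α ^ i = 0`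
(`mem_puncturedReedMuller_sub_two_iff`). A set of check positions of this code is therefore a set of
exponents `i` for which the elements `α ^ i` form an `𝔽₂`-basis of `K`.

The central point is that the rectangle is such a set (`exists_basis_rectangle`). The isomorphism
`T` turns `α ^ i` into `β₁ ^ i₁ β₂ ^ i₂`, where `(i₁, i₂) = T i` and `β₁`, `β₂` are the roots of
unity at `T⁻¹(1, 0)` and `T⁻¹(0, 1)`. The degree of `β₁` over `𝔽₂` is the order `a` of `2` modulo
`r₁`, and `K = 𝔽₂(β₁)(β₂)`, so `β₂` has degree `m / a` over `𝔽₂(β₁)`; the basis is the product of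
the two power bases of this tower, and `a ∣ m` is the degree formula.

The first-order code consists of the affine functions. Lagrange interpolation shows that a word of
`R(1, m)` is a polynomial function whose exponents are `0` and powers of two
(`reedMuller_one_add`); conversely linear functionals are traces and the relevant power sums vanish
(`mem_reedMuller_one_of_affine`). An affine function is free on, and determined by, its values at
`0` and on a basis.

For the computation of `Γ`, the defining set of the Hamming code is the set of powers of two
modulo `n` (`cyclicDefiningSet_puncturedReedMuller`), so its image under `T` is the single orbit of
`T 1`, whose components are units. The only possible set of representatives is a singleton `{d}`,
and `Γ` is the rectangle with sides `m(d₁) = a` and `m(d) = m / a` (`Gam_eq_rectangle`).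
-/

namespace RMCode

/-! ### Information sets and coefficient sums -/

/-- The restriction of the words of a code to a set of positions. -/
def restrictPositions {G : Type*} (C : Submodule (ZMod 2) (BinAlg G)) (I : Set G) :
    C →ₗ[ZMod 2] (I → ZMod 2) where
  toFun x i := x.1.coeff (i : G)
  map_add' x y := by ext i; simp
  map_smul' c x := by ext i; simp

theorem finrank_positions {G : Type*} [Finite G] (I : Set G) :
    Module.finrank (ZMod 2) (I → ZMod 2) = I.ncard := by
  have := Fintype.ofFinite I
  rw [Module.finrank_fintype_fun_eq_card, ← Nat.card_eq_fintype_card, Nat.card_coe_set_eq]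

/-- If the entries at the positions in `I` are arbitrary and determine the word, then `I` is an
information set. -/
theorem isInformationSet_of_unique_extension {G : Type*} [Finite G]
    {C : Submodule (ZMod 2) (BinAlg G)} {I : Set G}
    (hex : ∀ v : I → ZMod 2, ∃ x ∈ C, ∀ i : I, x.coeff (i : G) = v i)
    (huniq : ∀ x ∈ C, (∀ i ∈ I, x.coeff i = 0) → x = 0) : IsInformationSet C I := by
  refine ⟨?_, hex⟩
  have hf : Function.Bijective (restrictPositions C I) := by
    constructor
    · rw [← LinearMap.ker_eq_bot, LinearMap.ker_eq_bot']
      intro x hx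
      exact Subtype.ext (huniq x x.2 fun i hi => congrFun hx ⟨i, hi⟩)
    · intro v
      obtain ⟨x, hx, hv⟩ := hex v
      exact ⟨⟨x, hx⟩, funext hv⟩
  rw [(LinearEquiv.ofBijective _ hf).finrank_eq, finrank_positions]

theorem IsInformationSet.eq_zero {G : Type*} [Finite G]
    {C : Submodule (ZMod 2) (BinAlg G)} {I : Set G} (h : IsInformationSet C I)
    {x : BinAlg G} (hx : x ∈ C) (h0 : ∀ i ∈ I, x.coeff i = 0) : x = 0 := by
  have : Module.Finite (ZMod 2) (BinAlg G) :=
    .equiv ((Finsupp.linearEquivFunOnFinite (ZMod 2) (ZMod 2) G).symm.trans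
      (AddMonoidAlgebra.coeffLinearEquiv (ZMod 2)).symm)
  have hsurj : Function.Surjective (restrictPositions C I) := fun v => by
    obtain ⟨x, hx, hv⟩ := h.2 v
    exact ⟨⟨x, hx⟩, funext hv⟩
  have hinj := (LinearMap.injective_iff_surjective_of_finrank_eq_finrank
    (h.1.symm.trans (finrank_positions I).symm)).2 hsurj
  exact congrArg Subtype.val (@hinj ⟨x, hx⟩ 0 (funext fun i => h0 i i.2))

theorem exists_coeff_eq {G : Type*} [Finite G] (f : G → ZMod 2) :
    ∃ x : BinAlg G, ∀ g, x.coeff g = f g :=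
  ⟨.ofCoeff (Finsupp.equivFunOnFinite.symm f), fun _ => rfl⟩

theorem linearCombination_coeff_eq_sum {G K : Type*} [Fintype G] [Field K] [Algebra (ZMod 2) K]
    (v : G → K) (x : BinAlg G) :
    Finsupp.linearCombination (ZMod 2) v x.coeff =
      ∑ g, algebraMap (ZMod 2) K (x.coeff g) * v g := by
  rw [Finsupp.linearCombination_apply, Finsupp.sum_fintype _ _ (by simp)]
  simp [Algebra.smul_def]

/-! ### Binary weights -/

theorem wt_two_mul (k : ℕ) : wt (2 * k) = wt k := by
  rcases Nat.eq_zero_or_pos k with rfl | hk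
  · simp
  · simp [wt, Nat.digits_def' one_lt_two (by omega : 0 < 2 * k)]

theorem wt_two_mul_add_one (k : ℕ) : wt (2 * k + 1) = wt k + 1 := by
  have h1 : (2 * k + 1) % 2 = 1 := by omega
  have h2 : (2 * k + 1) / 2 = k := by omega
  rw [wt, Nat.digits_def' one_lt_two (by omega : 0 < 2 * k + 1), h1, h2, List.sum_cons, add_comm,
    wt]

theorem wt_zero : wt 0 = 0 := by simp [wt]

theorem wt_two_pow (j : ℕ) : wt (2 ^ j) = 1 := by
  induction j with
  | zero => simp [wt]
  | succ j ih => rw [pow_succ', wt_two_mul, ih]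

theorem eq_zero_of_wt_eq_zero (k : ℕ) (h : wt k = 0) : k = 0 := by
  induction k using Nat.strong_induction_on with
  | _ k ih =>
    obtain ⟨l, rfl | rfl⟩ := Nat.even_or_odd' k
    · rw [wt_two_mul] at h
      by_contra h0
      have := ih l (by omega) h
      omega
    · rw [wt_two_mul_add_one] at h
      omega

theorem eq_two_pow_of_wt_eq_one (k : ℕ) (h : wt k = 1) : ∃ j, k = 2 ^ j := by
  induction k using Nat.strong_induction_on with
  | _ k ih =>
    obtain ⟨l, rfl | rfl⟩ := Nat.even_or_odd' k
    · rw [wt_two_mul] at h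
      obtain ⟨j, rfl⟩ := ih l (by
        rcases Nat.eq_zero_or_pos l with rfl | hl
        · simp [wt_zero] at h
        · omega) h
      exact ⟨j + 1, (pow_succ' 2 j).symm⟩
    · rw [wt_two_mul_add_one] at h
      rw [eq_zero_of_wt_eq_zero l (by omega)]
      exact ⟨0, rfl⟩

/-- Complementing the `m` binary digits of `t` exchanges zeros and ones. -/
theorem wt_complement (m t : ℕ) (ht : t < 2 ^ m) : wt (2 ^ m - 1 - t) + wt t = m := by
  induction m generalizing t with
  | zero =>
    obtain rfl : t = 0 := by simpa using ht
    simp [wt_zero]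
  | succ m ih =>
    rw [pow_succ'] at ht ⊢
    obtain ⟨l, rfl | rfl⟩ := Nat.even_or_odd' t
    · have h := ih l (by omega)
      rw [show 2 * 2 ^ m - 1 - 2 * l = 2 * (2 ^ m - 1 - l) + 1 by omega, wt_two_mul_add_one,
        wt_two_mul]
      omega
    · have h := ih l (by omega)
      rw [show 2 * 2 ^ m - 1 - (2 * l + 1) = 2 * (2 ^ m - 1 - l) by omega, wt_two_mul_add_one,
        wt_two_mul]
      omega

/-! ### The first-order Reed-Muller code consists of the affine functions -/

/-- The power sum `∑ g ^ k` over a finite field vanishes unless `k` is a positive multiple of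
`q - 1`. -/
theorem sum_pow_eq_zero {K : Type*} [Field K] [Fintype K] (k : ℕ) (hk : 0 < k)
    (hdvd : ¬ Fintype.card K - 1 ∣ k) :
    ∑ g : K, g ^ k = 0 := by
  have hq : 0 < Fintype.card K - 1 := by
    have := Fintype.one_lt_card (α := K)
    omega
  have hr : k % (Fintype.card K - 1) ≠ 0 := fun h => hdvd (Nat.dvd_of_mod_eq_zero h)
  rw [← FiniteField.sum_pow_lt_card_sub_one K _ (Nat.mod_lt k hq)]
  refine Finset.sum_congr rfl fun g _ => ?_
  rcases eq_or_ne g 0 with rfl | hg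
  · rw [zero_pow hk.ne', zero_pow hr]
  · conv_lhs => rw [← Nat.mod_add_div k (Fintype.card K - 1), pow_add, pow_mul,
      FiniteField.pow_card_sub_one_eq_one g hg, one_pow, mul_one]

section FirstOrder

variable {K : Type*} [Field K] [Algebra (ZMod 2) K]

theorem add_pow_two_pow (x y : K) (j : ℕ) : (x + y) ^ 2 ^ j = x ^ 2 ^ j + y ^ 2 ^ j := by
  have : CharP K 2 := charP_of_injective_algebraMap (algebraMap (ZMod 2) K).injective 2
  exact add_pow_char_pow x y 2 j

theorem algebraMap_pow_two_pow (c : ZMod 2) (j : ℕ) :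
    (algebraMap (ZMod 2) K c) ^ 2 ^ j = algebraMap (ZMod 2) K c := by
  rw [← map_pow, ZMod.pow_card_pow]

theorem phi_eq_sum [Fintype K] (s : ℕ) (x : BinAlg K) :
    phi s x = ∑ g : K, algebraMap (ZMod 2) K (x.coeff g) * g ^ s :=
  linearCombination_coeff_eq_sum _ x

/-- Lagrange interpolation over `K`: the coefficient of `h ^ t` in the polynomial representing
`x` is `-φ_{q - 1 - t} x`, up to the contribution of `φ_0 x`. -/
theorem coeff_eq_phi_zero_sub_sum [Fintype K] (x : BinAlg K) (h : K) :
    algebraMap (ZMod 2) K (x.coeff h) = phi 0 x -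
      ∑ t ∈ Finset.range (Fintype.card K), h ^ t * phi (Fintype.card K - 1 - t) x := by
  classical
  have hgeom : ∀ g : K, ∑ t ∈ Finset.range (Fintype.card K), h ^ t * g ^ (Fintype.card K - 1 - t)
      = if g = h then 0 else 1 := by
    intro g
    split_ifs with hgh
    · subst hgh
      rw [Finset.sum_congr rfl fun t ht => by
        rw [← pow_add, Nat.add_sub_cancel' (by have := Finset.mem_range.1 ht; omega)]]
      simp
    · have h1 := geom_sum₂_mul h g (Fintype.card K)
      rw [FiniteField.pow_card, FiniteField.pow_card] at h1
      exact mul_right_cancel₀ (sub_ne_zero.2 (Ne.symm hgh)) (h1.trans (one_mul _).symm)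
  simp only [phi_eq_sum, Finset.mul_sum]
  rw [Finset.sum_comm, ← Finset.sum_sub_distrib]
  have hterm : ∀ g : K, algebraMap (ZMod 2) K (x.coeff g) * g ^ 0 -
      ∑ t ∈ Finset.range (Fintype.card K), h ^ t *
        (algebraMap (ZMod 2) K (x.coeff g) * g ^ (Fintype.card K - 1 - t)) =
      if g = h then algebraMap (ZMod 2) K (x.coeff g) else 0 := by
    intro g
    have : ∑ t ∈ Finset.range (Fintype.card K), h ^ t *
        (algebraMap (ZMod 2) K (x.coeff g) * g ^ (Fintype.card K - 1 - t)) =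
        algebraMap (ZMod 2) K (x.coeff g) * if g = h then 0 else 1 := by
      rw [← hgeom g, Finset.mul_sum]
      exact Finset.sum_congr rfl fun t _ => by ring
    rw [this]
    split_ifs <;> simp
  simp only [hterm, Finset.sum_ite_eq', Finset.mem_univ, if_true]

/-- Words of `R(1, m)` are additive up to a constant: in the interpolation formula only the
exponents `t` with `wt (q - 1 - t) ≥ m - 1` survive, and by complementation of binary digits these
are `0` and the powers of two. -/
theorem reedMuller_one_add [Fintype K] {m : ℕ} (hm : 2 ≤ m) (hK : Fintype.card K = 2 ^ m)
    {x : BinAlg K} (hx : x ∈ reedMuller K 1 m) (g h : K) :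
    x.coeff (g + h) + x.coeff 0 = x.coeff g + x.coeff h := by
  have hlt : 4 ≤ 2 ^ m := by simpa using Nat.pow_le_pow_right (n := 2) (by norm_num) hm
  have h0 : phi 0 x = 0 := hx 0 ⟨by omega, by rw [wt_zero]; omega⟩
  have hadd : ∀ t, t ≠ 0 → t < 2 ^ m →
      (g + h) ^ t * phi (2 ^ m - 1 - t) x =
        g ^ t * phi (2 ^ m - 1 - t) x + h ^ t * phi (2 ^ m - 1 - t) x := by
    intro t ht htm
    by_cases hwt : wt (2 ^ m - 1 - t) < m - 1
    · rw [hx _ ⟨by omega, hwt⟩]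
      simp
    · have h1 := wt_complement m t htm
      have h2 : wt t ≠ 0 := fun h => ht (eq_zero_of_wt_eq_zero t h)
      obtain ⟨j, rfl⟩ := eq_two_pow_of_wt_eq_one t (by omega)
      rw [add_pow_two_pow, add_mul]
  apply (algebraMap (ZMod 2) K).injective
  have hsplit : ∀ y : K, algebraMap (ZMod 2) K (x.coeff y) = - phi (2 ^ m - 1) x -
      ∑ t ∈ Finset.range (2 ^ m - 1), y ^ (t + 1) * phi (2 ^ m - 1 - (t + 1)) x := by
    intro y
    rw [coeff_eq_phi_zero_sub_sum, hK, h0, ← Nat.sub_add_cancel (by omega : 1 ≤ 2 ^ m),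
      Finset.sum_range_succ']
    simp
    ring
  simp only [map_add, hsplit]
  rw [Finset.sum_congr rfl fun t ht => hadd (t + 1) (by omega)
    (by have := Finset.mem_range.1 ht; omega), Finset.sum_add_distrib]
  simp
  ring

/-- Every affine function belongs to the first-order code: a linear functional is `Tr (b ·)`, and
expanding the trace turns `φ_s` into a combination of vanishing power sums. -/
theorem mem_reedMuller_one_of_affine [Fintype K] {m : ℕ} (hm : 2 ≤ m)
    (hK : Fintype.card K = 2 ^ m) {x : BinAlg K} (c : ZMod 2) (l : Module.Dual (ZMod 2) K)
    (hx : ∀ g, x.coeff g = c + l g) : x ∈ reedMuller K 1 m := by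
  intro s hs
  obtain ⟨hs, hwt⟩ := hs
  have hrank : Module.finrank (ZMod 2) K = m := by
    have h := Module.card_eq_pow_finrank (K := ZMod 2) (V := K)
    rw [hK, ZMod.card] at h
    exact (Nat.pow_right_injective le_rfl h).symm
  obtain ⟨b, hb⟩ : ∃ b : K, ∀ g, l g = Algebra.trace (ZMod 2) K (b * g) := by
    obtain ⟨b, hb⟩ := (LinearMap.BilinForm.toDual _
      (traceForm_nondegenerate (ZMod 2) K)).surjective l
    exact ⟨b, fun g => by rw [← hb, LinearMap.BilinForm.toDual_def, Algebra.traceForm_apply]⟩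
  have hlin : ∀ j ∈ Finset.range m, ∑ g : K, (b * g) ^ 2 ^ j * g ^ s = 0 := by
    intro j hj
    rw [Finset.mem_range] at hj
    have hle : 2 * 2 ^ j ≤ 2 ^ m := by
      rw [← pow_succ']
      exact Nat.pow_le_pow_right (by norm_num) hj
    have hpos : 0 < 2 ^ j := by positivity
    simp only [mul_pow, mul_assoc, ← pow_add]
    rw [← Finset.mul_sum, sum_pow_eq_zero _ (by omega), mul_zero]
    rintro ⟨k, hk⟩
    rw [hK] at hk
    -- The exponent is positive and less than `2 * (2 ^ m - 1)`.
    have hk1 : k = 1 := by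
      have h1 : k ≠ 0 := by rintro rfl; omega
      have h2 : k < 2 := by
        by_contra h
        have := Nat.mul_le_mul_left (2 ^ m - 1) (not_lt.1 h)
        omega
      omega
    subst hk1
    have := wt_complement m (2 ^ j) (by omega)
    rw [wt_two_pow, show 2 ^ m - 1 - 2 ^ j = s by omega] at this
    omega
  rw [phi_eq_sum]
  have hexp : ∀ g : K, algebraMap (ZMod 2) K (x.coeff g) * g ^ s =
      algebraMap (ZMod 2) K c * g ^ s + ∑ j ∈ Finset.range m, (b * g) ^ 2 ^ j * g ^ s := by
    intro g
    rw [hx, hb, map_add, FiniteField.algebraMap_trace_eq_sum_pow, hrank, add_mul, Finset.sum_mul]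
    simp
  rw [Finset.sum_congr rfl fun g _ => hexp g, Finset.sum_add_distrib, ← Finset.mul_sum,
    FiniteField.sum_pow_lt_card_sub_one K s (by rw [hK]; omega), Finset.sum_comm,
    Finset.sum_eq_zero hlin]
  simp

end FirstOrder

/-! ### Powers of a primitive root indexed by residues -/

section PrimitiveRoot

variable {K : Type*} [Field K] {n : ℕ} [NeZero n] {α : K}

theorem pow_val_add (hα : IsPrimitiveRoot α n) (i j : ZMod n) :
    α ^ (i + j).val = α ^ i.val * α ^ j.val := by
  rw [ZMod.val_add, ← pow_add, ← pow_eq_pow_mod _ hα.pow_eq_one]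

theorem pow_val_nsmul (hα : IsPrimitiveRoot α n) (k : ℕ) (i : ZMod n) :
    α ^ (k • i).val = (α ^ i.val) ^ k := by
  induction k with
  | zero => simp
  | succ k ih => rw [succ_nsmul, pow_val_add hα, ih, pow_succ]

theorem pow_val_injective (hα : IsPrimitiveRoot α n) :
    Function.Injective fun i : ZMod n => α ^ i.val := fun i j h =>
  ZMod.val_injective n (hα.pow_inj (ZMod.val_lt i) (ZMod.val_lt j) h)

theorem pow_val_ne_zero (hα : IsPrimitiveRoot α n) (i : ZMod n) : α ^ i.val ≠ 0 :=
  pow_ne_zero _ (hα.ne_zero (NeZero.ne n))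

/-- The elements of `K` are `0` and the powers of a generator of the multiplicative group. -/
theorem bijective_elim_pow_val [Finite K] (hα : IsPrimitiveRoot α n) (hK : Nat.card K = n + 1) :
    Function.Bijective fun o : Option (ZMod n) => o.elim (0 : K) fun i => α ^ i.val := by
  have := Fintype.ofFinite K
  rw [Fintype.bijective_iff_injective_and_card]
  constructor
  · rintro (_ | i) (_ | j) h
    · rfl
    · exact absurd h.symm (pow_val_ne_zero hα j)
    · exact absurd h (pow_val_ne_zero hα i)
    · exact congrArg some (pow_val_injective hα h)
  · rw [Fintype.card_option, ZMod.card, ← Nat.card_eq_fintype_card, hK]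

theorem exists_eq_pow_val [Finite K] (hα : IsPrimitiveRoot α n) (hK : Nat.card K = n + 1)
    {g : K} (hg : g ≠ 0) : ∃ i : ZMod n, g = α ^ i.val := by
  obtain ⟨_ | i, h⟩ := (bijective_elim_pow_val hα hK).2 g
  · exact absurd h.symm hg
  · exact ⟨i, h.symm⟩

theorem sum_eq_zero_add_sum_pow_val [Fintype K] {M : Type*} [AddCommMonoid M]
    (hα : IsPrimitiveRoot α n) (hK : Nat.card K = n + 1) (f : K → M) :
    ∑ g, f g = f 0 + ∑ i : ZMod n, f (α ^ i.val) := by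
  rw [← (bijective_elim_pow_val hα hK).sum_comp, Fintype.sum_option]
  rfl

variable {r₁ r₂ : ℕ} (T : ZMod n ≃+ ZMod r₁ × ZMod r₂)

theorem pow_val_eq_mul [NeZero r₁] [NeZero r₂] (hα : IsPrimitiveRoot α n) (i : ZMod n) :
    α ^ i.val = (α ^ (T.symm (1, 0)).val) ^ (T i).1.val *
      (α ^ (T.symm (0, 1)).val) ^ (T i).2.val := by
  rw [← pow_val_nsmul hα, ← pow_val_nsmul hα, ← pow_val_add hα, ← map_nsmul, ← map_nsmul,
    ← map_add]
  congr 2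
  rw [T.eq_symm_apply]
  ext <;> simp

theorem isPrimitiveRoot_pow_val_symm (hα : IsPrimitiveRoot α n) :
    IsPrimitiveRoot (α ^ (T.symm (1, 0)).val) r₁ := by
  have key : ∀ l : ℕ, (α ^ (T.symm (1, 0)).val) ^ l = 1 ↔ r₁ ∣ l := by
    intro l
    have h1 : α ^ (0 : ZMod n).val = 1 := by simp
    rw [← pow_val_nsmul hα, ← h1, (pow_val_injective hα).eq_iff, ← map_nsmul,
      EmbeddingLike.map_eq_zero_iff, ← ZMod.natCast_eq_zero_iff]
    simp [Prod.ext_iff]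
  exact ⟨(key _).2 dvd_rfl, fun l => (key l).1⟩

end PrimitiveRoot

/-! ### A basis consisting of the powers at the positions of a rectangle -/

section Basis

variable {K : Type*} [Field K]

theorem natDegree_minpoly_le {F : Type*} [Field F] [Algebra F K] {β : K} {r : ℕ} (hr : 0 < r)
    (hβ : β ^ r = 1) : (minpoly F β).natDegree ≤ r := by
  have h0 : (Polynomial.X ^ r - 1 : Polynomial F) ≠ 0 := Polynomial.X_pow_sub_C_ne_zero hr 1
  have h := Polynomial.natDegree_le_of_dvd (minpoly.dvd F β (p := Polynomial.X ^ r - 1)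
    (by simp [hβ])) h0
  rwa [← Polynomial.C_1, Polynomial.natDegree_X_pow_sub_C] at h

variable [Algebra (ZMod 2) K]

theorem natDegree_minpoly_eq_orderOf [Finite K] {β : K} {r : ℕ} (hr : Odd r)
    (hβ : IsPrimitiveRoot β r) :
    (minpoly (ZMod 2) β).natDegree = orderOf (2 : ZMod r) := by
  have hcop : Nat.Coprime 2 r := Nat.coprime_two_left.2 hr
  have hint : IsIntegral (ZMod 2) β := .of_finite _ _
  have : NeZero r := ⟨hr.pos.ne'⟩
  have : NeZero (r : K) := hβ.neZero'
  rw [Polynomial.natDegree_of_dvd_cyclotomic_of_irreducible (p := 2) (f := 1) (by simp) hcop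
    (minpoly.dvd _ _ ?_) (minpoly.irreducible hint), ← orderOf_units]
  · simp
  · rw [Polynomial.aeval_def, Polynomial.eval₂_eq_eval_map, Polynomial.map_cyclotomic]
    exact hβ.isRoot_cyclotomic hr.pos

/-- The product basis of the tower `𝔽₂ ⊆ 𝔽₂(β₁) ⊆ 𝔽₂(β₁)(β₂) = K`, where `β₁` and `β₂` are the
roots of unity at the positions `T⁻¹(1, 0)` and `T⁻¹(0, 1)`. -/
theorem exists_basis_rectangle [Finite K] {n r₁ r₂ : ℕ} [NeZero n] [NeZero r₁] [NeZero r₂]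
    {α : K} (hα : IsPrimitiveRoot α n) (hK : Nat.card K = n + 1)
    (T : ZMod n ≃+ ZMod r₁ × ZMod r₂) (hr₁ : Odd r₁) :
    orderOf (2 : ZMod r₁) ∣ Module.finrank (ZMod 2) K ∧
    ∃ b : Module.Basis ↥(T ⁻¹' rectangle r₁ r₂ (orderOf (2 : ZMod r₁))
        (Module.finrank (ZMod 2) K / orderOf (2 : ZMod r₁))) (ZMod 2) K,
      ∀ i, b i = α ^ (i : ZMod n).val := by
  set β₁ := α ^ (T.symm (1, 0)).val with hβ₁
  set β₂ := α ^ (T.symm (0, 1)).val with hβ₂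
  set a := orderOf (2 : ZMod r₁) with ha
  set d := Module.finrank (ZMod 2) K with hd
  have hprim : IsPrimitiveRoot β₁ r₁ := isPrimitiveRoot_pow_val_symm T hα
  have hpow₂ : β₂ ^ r₂ = 1 := by
    rw [hβ₂, ← pow_val_nsmul hα, ← map_nsmul,
      show r₂ • ((0, 1) : ZMod r₁ × ZMod r₂) = 0 by ext <;> simp]
    simp
  have hint₁ : IsIntegral (ZMod 2) β₁ := .of_finite _ _
  have hdeg₁ : (minpoly (ZMod 2) β₁).natDegree = a := natDegree_minpoly_eq_orderOf hr₁ hprim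
  let L := IntermediateField.adjoin (ZMod 2) {β₁}
  have hL : Module.finrank (ZMod 2) L = a := by
    rw [← hdeg₁]
    exact IntermediateField.adjoin.finrank hint₁
  have hint₂ : IsIntegral L β₂ := .of_finite _ _
  have htop : IntermediateField.adjoin L {β₂} = ⊤ := by
    rw [eq_top_iff]
    intro x _
    rcases eq_or_ne x 0 with rfl | hx
    · exact zero_mem _
    obtain ⟨i, rfl⟩ := exists_eq_pow_val hα hK hx
    rw [pow_val_eq_mul T hα]
    refine mul_mem (pow_mem ?_ _) (pow_mem (IntermediateField.mem_adjoin_simple_self L β₂) _)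
    exact (IntermediateField.adjoin L {β₂}).algebraMap_mem
      (IntermediateField.AdjoinSimple.gen (ZMod 2) β₁)
  have hdeg₂ : (minpoly L β₂).natDegree = Module.finrank L K := by
    rw [← IntermediateField.adjoin.finrank hint₂, htop, IntermediateField.finrank_top']
  have htower : a * (minpoly L β₂).natDegree = d := by
    rw [hdeg₂, ← hL, Module.finrank_mul_finrank]
  have hapos : 0 < a := by rw [← hdeg₁]; exact minpoly.natDegree_pos hint₁
  have hdiv : d / a = (minpoly L β₂).natDegree := by
    rw [← htower, Nat.mul_div_cancel_left _ hapos]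
  refine ⟨⟨_, htower.symm⟩, ?_⟩
  have ha_le : a ≤ r₁ := hdeg₁ ▸ natDegree_minpoly_le (NeZero.pos r₁) hprim.pow_eq_one
  have hb_le : d / a ≤ r₂ := hdiv ▸ natDegree_minpoly_le (NeZero.pos r₂) hpow₂
  have hli₁ : LinearIndependent (ZMod 2) fun i : Fin a =>
      IntermediateField.AdjoinSimple.gen (ZMod 2) β₁ ^ (i : ℕ) := by
    have h := linearIndependent_pow (K := ZMod 2) (IntermediateField.AdjoinSimple.gen (ZMod 2) β₁)
    rwa [IntermediateField.minpoly_gen, hdeg₁] at h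
  have hli₂ : LinearIndependent L fun j : Fin (d / a) => β₂ ^ (j : ℕ) := by
    rw [hdiv]
    exact linearIndependent_pow β₂
  have hli := linearIndependent_smul hli₁ hli₂
  let b := basisOfLinearIndependentOfCardEqFinrank' _ hli (by simp [hdiv, htower, ← hd])
  let e : Fin a × Fin (d / a) ≃ ↥(T ⁻¹' rectangle r₁ r₂ a (d / a)) :=
    { toFun := fun p => ⟨T.symm ((p.1 : ℕ), (p.2 : ℕ)), by
        simp [rectangle, ZMod.val_cast_of_lt (p.1.2.trans_le ha_le),
          ZMod.val_cast_of_lt (p.2.2.trans_le hb_le)]⟩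
      invFun := fun i => (⟨(T i).1.val, i.2.1⟩, ⟨(T i).2.val, i.2.2⟩)
      left_inv := fun p => by
        ext <;> simp [ZMod.val_cast_of_lt (p.1.2.trans_le ha_le),
          ZMod.val_cast_of_lt (p.2.2.trans_le hb_le)]
      right_inv := fun i => by simp }
  refine ⟨b.reindex e, fun i => ?_⟩
  rw [Module.Basis.reindex_apply, pow_val_eq_mul T hα]
  simp [b, e, Algebra.smul_def, ← hβ₁, ← hβ₂]

end Basis

/-! ### The Hamming code and its extension -/

theorem exists_extension {G M : Type*} [Zero M] {S : Set G} (v : S → M) :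
    ∃ w : G → M, ∀ g : S, w g = v g := by
  classical
  exact ⟨fun g => if h : g ∈ S then v ⟨g, h⟩ else 0, fun g => dif_pos g.2⟩

theorem exists_coeff_zero_pow_val {K : Type*} [Field K] [Finite K] {n : ℕ} [NeZero n] {α : K}
    (hα : IsPrimitiveRoot α (n))
    (hK : Nat.card K = n + 1) (u : ZMod 2) (f : ZMod (n) → ZMod 2) :
    ∃ x : BinAlg K, x.coeff 0 = u ∧ ∀ i, x.coeff (α ^ i.val) = f i := by
  let e := Equiv.ofBijective _ (bijective_elim_pow_val hα hK)
  obtain ⟨x, hx⟩ := exists_coeff_eq fun g : K => (e.symm g).elim u f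
  refine ⟨x, ?_, fun i => ?_⟩
  · rw [hx, show e.symm 0 = none from e.symm_apply_eq.2 rfl]
    rfl
  · rw [hx, show e.symm (α ^ i.val) = some i from e.symm_apply_eq.2 rfl]
    rfl

section Hamming

variable {K : Type*} [Field K] [Algebra (ZMod 2) K]

theorem sum_pow_two_pow {ι : Type*} (s : Finset ι) (f : ι → K) (j : ℕ) :
    (∑ i ∈ s, f i) ^ 2 ^ j = ∑ i ∈ s, f i ^ 2 ^ j := by
  have : CharP K 2 := charP_of_injective_algebraMap (algebraMap (ZMod 2) K).injective 2
  exact sum_pow_char_pow 2 j s f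

/-- The words of `R(m - 2, m)` are those of even weight whose positions sum to `0`: the remaining
exponents in the defining set are powers of two, and `φ_{2 ^ j} x = (φ_1 x) ^ (2 ^ j)`. -/
theorem mem_reedMuller_sub_two_iff [Finite K] {m : ℕ} (hm : 2 ≤ m) (x : BinAlg K) :
    x ∈ reedMuller K (m - 2) m ↔ phi 0 x = 0 ∧ phi 1 x = 0 := by
  have := Fintype.ofFinite K
  have hlt : 4 ≤ 2 ^ m := by simpa using Nat.pow_le_pow_right (n := 2) (by norm_num) hm
  constructor
  · intro hx
    exact ⟨hx 0 ⟨by omega, by rw [wt_zero]; omega⟩,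
      hx 1 ⟨by omega, by have := wt_two_pow 0; rw [pow_zero] at this; omega⟩⟩
  · rintro ⟨h0, h1⟩ s ⟨-, hs⟩
    rcases (show wt s = 0 ∨ wt s = 1 by omega) with h | h
    · rw [eq_zero_of_wt_eq_zero s h, h0]
    · obtain ⟨j, rfl⟩ := eq_two_pow_of_wt_eq_one s h
      rw [phi_eq_sum] at h1 ⊢
      have h2 := congrArg (· ^ 2 ^ j) h1
      simp only [sum_pow_two_pow, mul_pow, algebraMap_pow_two_pow, pow_one] at h2
      rw [h2, zero_pow (by positivity)]

/-- A basis of `K` together with `0` is an affine frame, so affine functions on `K` have arbitrary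
values there and are determined by them. -/
theorem isInformationSet_reedMuller_one [Finite K] {m n : ℕ} {α : K} {I : Set (ZMod n)}
    (b : Module.Basis I (ZMod 2) K) (hm : 2 ≤ m) (hK : Nat.card K = 2 ^ m)
    (hb : ∀ i, b i = α ^ (i : ZMod n).val) :
    IsInformationSet (reedMuller K 1 m) (insert 0 {g | ∃ i ∈ I, g = α ^ i.val}) := by
  have := Fintype.ofFinite K
  rw [Nat.card_eq_fintype_card] at hK
  refine isInformationSet_of_unique_extension (fun v => ?_) fun x hx hv => ?_
  · obtain ⟨w, hw⟩ := exists_extension v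
    obtain ⟨x, hx⟩ := exists_coeff_eq fun g : K =>
      w 0 + b.constr (ZMod 2) (fun i => w (b i) - w 0) g
    refine ⟨x, mem_reedMuller_one_of_affine hm hK _ _ hx, fun g => ?_⟩
    obtain ⟨g, hg⟩ := g
    rw [← hw, hx]
    change w 0 + b.constr (ZMod 2) (fun i => w (b i) - w 0) g = w g
    obtain rfl | ⟨i, hi, rfl⟩ := hg
    · simp
    · rw [← hb ⟨i, hi⟩, b.constr_basis, add_sub_cancel]
  · have h0 : x.coeff 0 = 0 := hv 0 (Set.mem_insert _ _)
    have hadd : ∀ g h, x.coeff (g + h) = x.coeff g + x.coeff h := fun g h => by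
      rw [← reedMuller_one_add hm hK hx, h0, add_zero]
    let l := (AddMonoidHom.mk' (fun g => x.coeff g) hadd).toZModLinearMap 2
    have hl : l = 0 := b.ext fun i => hv _ (Or.inr ⟨i, i.2, hb i⟩)
    apply AddMonoidAlgebra.coeff_injective
    ext g
    exact LinearMap.congr_fun hl g

variable {m : ℕ} [NeZero (2 ^ m - 1)] {α : K}

/-- The punctured code `R*(m - 2, m)` is the Hamming code with parity-check columns `α ^ i`: the
deleted coordinate is a parity bit. -/
theorem mem_puncturedReedMuller_sub_two_iff [Finite K] (hm : 2 ≤ m)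
    (hα : IsPrimitiveRoot α (2 ^ m - 1)) (hK : Nat.card K = 2 ^ m - 1 + 1)
    (c : BinAlg (ZMod (2 ^ m - 1))) :
    c ∈ puncturedReedMuller α (m - 2) m ↔
      ∑ i, algebraMap (ZMod 2) K (c.coeff i) * α ^ i.val = 0 := by
  have := Fintype.ofFinite K
  have hphi : ∀ x : BinAlg K, (∀ i, c.coeff i = x.coeff (α ^ i.val)) →
      phi 1 x = ∑ i, algebraMap (ZMod 2) K (c.coeff i) * α ^ i.val := by
    intro x hx
    rw [phi_eq_sum, sum_eq_zero_add_sum_pow_val hα hK]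
    simp [hx]
  constructor
  · rintro ⟨x, hx, hc⟩
    rw [← hphi x hc, ((mem_reedMuller_sub_two_iff hm x).1 hx).2]
  · intro h
    obtain ⟨x, hx0, hx⟩ := exists_coeff_zero_pow_val hα hK (∑ i, c.coeff i) fun i => c.coeff i
    refine ⟨x, (mem_reedMuller_sub_two_iff hm x).2 ⟨?_, ?_⟩, fun i => (hx i).symm⟩
    · rw [phi_eq_sum, sum_eq_zero_add_sum_pow_val hα hK, hx0]
      simp only [hx, pow_zero, mul_one, ← map_sum, ← map_add, CharTwo.add_self_eq_zero, map_zero]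
    · rw [hphi x fun i => (hx i).symm, h]

variable {I : Set (ZMod (2 ^ m - 1))} (b : Module.Basis I (ZMod 2) K)

/-- Columns of the parity-check matrix forming a basis are a set of check positions. -/
theorem isCheckPositions_of_basis [Finite K] (hm : 2 ≤ m) (hα : IsPrimitiveRoot α (2 ^ m - 1))
    (hK : Nat.card K = 2 ^ m - 1 + 1) (hb : ∀ i, b i = α ^ (i : ZMod (2 ^ m - 1)).val) :
    IsCheckPositions (puncturedReedMuller α (m - 2) m) I := by
  classical
  have hsplit : ∀ f : ZMod (2 ^ m - 1) → K,
      ∑ i, f i = ∑ i : I, f i + ∑ i : ↥Iᶜ, f i := by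
    intro f
    exact (Fintype.sum_subtype_add_sum_subtype (· ∈ I) f).symm
  refine isInformationSet_of_unique_extension (fun v => ?_) fun c hc hv => ?_
  · let w : K := ∑ i : ↥Iᶜ, algebraMap (ZMod 2) K (v i) * α ^ (i : ZMod (2 ^ m - 1)).val
    obtain ⟨c, hc⟩ := exists_coeff_eq fun i : ZMod (2 ^ m - 1) =>
      if h : i ∈ I then - b.repr w ⟨i, h⟩ else v ⟨i, h⟩
    have hin : ∀ i : I, c.coeff i = - b.repr w i := fun i => by rw [hc, dif_pos i.2]
    have hout : ∀ i : ↥Iᶜ, c.coeff i = v i := fun i => by rw [hc, dif_neg i.2]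
    refine ⟨c, ?_, hout⟩
    rw [mem_puncturedReedMuller_sub_two_iff hm hα hK, hsplit]
    simp only [hin, hout, ← hb, map_neg, neg_mul, ← Algebra.smul_def, Finset.sum_neg_distrib]
    rw [b.sum_repr]
    simp [w, Algebra.smul_def]
  · rw [mem_puncturedReedMuller_sub_two_iff hm hα hK, hsplit] at hc
    rw [Finset.sum_eq_zero (s := (Finset.univ : Finset ↥Iᶜ)) fun i _ => by
      rw [hv i i.2, map_zero, zero_mul], add_zero] at hc
    simp only [← hb, ← Algebra.smul_def] at hc
    have hzero := Fintype.linearIndependent_iff.1 b.linearIndependent (fun i => c.coeff i) hc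
    apply AddMonoidAlgebra.coeff_injective
    ext i
    by_cases hi : i ∈ I
    · exact hzero ⟨i, hi⟩
    · exact hv i hi

/-- Puncturing is injective on `R(m - 2, m)`, because the deleted coordinate is a parity bit. -/
theorem isInformationSet_reedMuller_sub_two [Finite K] (hm : 2 ≤ m)
    (hα : IsPrimitiveRoot α (2 ^ m - 1)) (hK : Nat.card K = 2 ^ m - 1 + 1)
    (hI : IsInformationSet (puncturedReedMuller α (m - 2) m) I) :
    IsInformationSet (reedMuller K (m - 2) m) {g | ∃ i ∈ I, g = α ^ i.val} := by
  have := Fintype.ofFinite K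
  refine isInformationSet_of_unique_extension (fun v => ?_) fun x hx hv => ?_
  · obtain ⟨w, hw⟩ := exists_extension v
    obtain ⟨c, ⟨x, hx, hc⟩, hcv⟩ := hI.2 fun i => w (α ^ (i : ZMod (2 ^ m - 1)).val)
    refine ⟨x, hx, ?_⟩
    rintro ⟨g, i, hi, rfl⟩
    rw [← hc, ← hw]
    exact hcv ⟨i, hi⟩
  · obtain ⟨c, hc⟩ := exists_coeff_eq fun i : ZMod (2 ^ m - 1) => x.coeff (α ^ i.val)
    have hc0 : c = 0 := hI.eq_zero ⟨x, hx, hc⟩ fun i hi => by rw [hc, hv _ ⟨i, hi, rfl⟩]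
    have hpow : ∀ i : ZMod (2 ^ m - 1), x.coeff (α ^ i.val) = 0 := fun i => by
      rw [← hc, hc0]
      simp
    have h0 := ((mem_reedMuller_sub_two_iff hm x).1 hx).1
    rw [phi_eq_sum, sum_eq_zero_add_sum_pow_val hα hK] at h0
    simp only [hpow, pow_zero, mul_one, map_zero, Finset.sum_const_zero, add_zero,
      map_eq_zero] at h0
    apply AddMonoidAlgebra.coeff_injective
    ext g
    rcases eq_or_ne g 0 with rfl | hg
    · exact h0
    · obtain ⟨i, rfl⟩ := exists_eq_pow_val hα hK hg
      exact hpow i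

end Hamming

/-! ### The defining set of the Hamming code -/

theorem sum_zmod_val {M : Type*} [AddCommMonoid M] (n : ℕ) [NeZero n] (f : ℕ → M) :
    ∑ i : ZMod n, f i.val = ∑ k ∈ Finset.range n, f k := by
  obtain ⟨k, rfl⟩ := Nat.exists_eq_succ_of_ne_zero (NeZero.ne n)
  exact Fin.sum_univ_eq_sum_range f (k + 1)

theorem lt_two_pow_sub_one {m : ℕ} (hm : 2 ≤ m) : m < 2 ^ m - 1 := by
  induction m, hm using Nat.le_induction with
  | base => norm_num
  | succ k hk ih => rw [pow_succ]; omega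

/-- The exponents in the defining set of the Hamming code are those `s` for which `α ^ s` is
conjugate to `α`: the minimal polynomial of `α` is a codeword, so it vanishes at `α ^ s`, which is
then the image of `α` under a power of the Frobenius automorphism. -/
theorem cyclicDefiningSet_puncturedReedMuller {K : Type*} [Field K] [Algebra (ZMod 2) K]
    [Finite K] {m : ℕ} [NeZero (2 ^ m - 1)] {α : K} (hm : 2 ≤ m)
    (hα : IsPrimitiveRoot α (2 ^ m - 1)) (hK : Nat.card K = 2 ^ m - 1 + 1)
    (hrank : Module.finrank (ZMod 2) K = m) :
    cyclicDefiningSet α (puncturedReedMuller α (m - 2) m) =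
      Set.range fun j : ℕ => (2 : ZMod (2 ^ m - 1)) ^ j := by
  have hpow : ∀ j : ℕ, α ^ ((2 : ZMod (2 ^ m - 1)) ^ j).val = α ^ 2 ^ j := by
    intro j
    rw [show (2 : ZMod (2 ^ m - 1)) ^ j = ((2 ^ j : ℕ) : ZMod (2 ^ m - 1)) by simp,
      ZMod.val_natCast, ← pow_eq_pow_mod _ hα.pow_eq_one]
  ext s
  simp only [cyclicDefiningSet, Set.mem_ofPred_eq, linearCombination_coeff_eq_sum, Set.mem_range]
  constructor
  · intro hs
    set P := minpoly (ZMod 2) α with hP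
    have hdeg : P.natDegree < 2 ^ m - 1 :=
      ((minpoly.natDegree_le α).trans hrank.le).trans_lt (lt_two_pow_sub_one hm)
    obtain ⟨c, hc⟩ := exists_coeff_eq fun i : ZMod (2 ^ m - 1) => P.coeff i.val
    have heval : ∀ y : K, ∑ i, algebraMap (ZMod 2) K (c.coeff i) * y ^ i.val =
        Polynomial.aeval y P := by
      intro y
      simp only [hc, ← Algebra.smul_def]
      rw [sum_zmod_val _ fun k => P.coeff k • y ^ k, Polynomial.aeval_eq_sum_range' hdeg]
    have h0 := hs c ((mem_puncturedReedMuller_sub_two_iff hm hα hK c).2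
      ((heval α).trans (minpoly.aeval _ _)))
    rw [heval] at h0
    have hconj := isConjRoot_of_aeval_eq_zero (.of_finite (ZMod 2) α) h0
    obtain ⟨σ, hσ⟩ := isConjRoot_iff_exists_algEquiv.1 hconj.symm
    obtain ⟨j, rfl⟩ := (FiniteField.bijective_frobeniusAlgEquivOfAlgebraic_pow (ZMod 2) K).2 σ
    refine ⟨j, pow_val_injective hα ?_⟩
    simp only
    rw [hpow, ← hσ]
    simp [AlgEquiv.coe_pow, FiniteField.coe_frobeniusAlgEquivOfAlgebraic_iterate]
  · rintro ⟨j, rfl⟩ c hc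
    rw [mem_puncturedReedMuller_sub_two_iff hm hα hK] at hc
    have h2 := congrArg (· ^ 2 ^ j) hc
    simp only [sum_pow_two_pow, mul_pow, algebraMap_pow_two_pow] at h2
    rw [zero_pow (by positivity)] at h2
    rw [← h2]
    exact Finset.sum_congr rfl fun i _ => by rw [hpow, pow_right_comm]

/-! ### The set `Γ` of a single orbit of units -/

theorem two_pow_eq_one_iff (r k : ℕ) : (2 : ZMod r) ^ k = 1 ↔ r ∣ 2 ^ k - 1 := by
  rw [← ZMod.natCast_eq_zero_iff, Nat.cast_sub Nat.one_le_two_pow, sub_eq_zero]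
  simp

theorem two_pow_sub_one_dvd_iff (m k : ℕ) : 2 ^ m - 1 ∣ 2 ^ k - 1 ↔ m ∣ k := by
  rw [← Nat.gcd_eq_left_iff_dvd, Nat.pow_sub_one_gcd_pow_sub_one, ← Nat.gcd_eq_left_iff_dvd]
  constructor
  · intro h
    have h1 := Nat.one_le_two_pow (n := m)
    have h2 := Nat.one_le_two_pow (n := m.gcd k)
    exact Nat.pow_right_injective le_rfl (show 2 ^ m.gcd k = 2 ^ m by omega)
  · intro h
    rw [h]

/-- A power of `2 ^ a`, with `a` the order of `2` modulo `r₁`, is `1` modulo `r₁`, so it is `1`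
modulo `r₂` exactly when it is `1` modulo `r₁ r₂ = 2 ^ m - 1`. -/
theorem orderOf_two_pow {m r₁ r₂ : ℕ} (hn : 2 ^ m - 1 = r₁ * r₂) (hcop : Nat.Coprime r₁ r₂)
    (ha : 0 < orderOf (2 : ZMod r₁)) (hdvd : orderOf (2 : ZMod r₁) ∣ m) :
    orderOf ((2 : ZMod r₂) ^ orderOf (2 : ZMod r₁)) = m / orderOf (2 : ZMod r₁) := by
  have key : ∀ k : ℕ, orderOf ((2 : ZMod r₂) ^ orderOf (2 : ZMod r₁)) ∣ k ↔
      m / orderOf (2 : ZMod r₁) ∣ k := by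
    intro k
    have h1 : r₁ ∣ 2 ^ (orderOf (2 : ZMod r₁) * k) - 1 := by
      rw [← two_pow_eq_one_iff, pow_mul, pow_orderOf_eq_one, one_pow]
    rw [orderOf_dvd_iff_pow_eq_one, ← pow_mul, two_pow_eq_one_iff,
      Nat.div_dvd_iff_dvd_mul hdvd ha, ← two_pow_sub_one_dvd_iff m, hn]
    exact ⟨fun h => hcop.mul_dvd_of_dvd_of_dvd h1 h, fun h => (Nat.dvd_mul_left _ _).trans h⟩
  exact Nat.dvd_antisymm ((key _).2 dvd_rfl) ((key _).1 dvd_rfl)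

theorem ncard_cyclotomicCoset {r : ℕ} (γ : ℕ) {u t : ZMod r} (hu : IsUnit u) (ht : IsUnit t)
    (h : t = 2 ^ γ) : (cyclotomicCoset γ r u).ncard = orderOf t := by
  obtain ⟨w, rfl⟩ := ht
  have himage : cyclotomicCoset γ r u =
      (fun x : (ZMod r)ˣ => u * x) '' (Submonoid.powers w : Set (ZMod r)ˣ) := by
    ext x
    simp [cyclotomicCoset, Submonoid.mem_powers_iff, pow_mul, h]
  rw [himage, Set.ncard_image_of_injective _ fun x y hxy => Units.ext (hu.mul_left_cancel hxy),
    orderOf_units, ← Nat.card_submonoidPowers, ← Nat.card_coe_set_eq]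
  rfl

theorem isUnit_two {r : ℕ} (hr : Odd r) : IsUnit (2 : ZMod r) := by
  simpa using (ZMod.unitOfCoprime 2 (Nat.coprime_two_left.2 hr)).isUnit

variable {r₁ r₂ : ℕ}

theorem mem_twoOrbit_self (e : ZMod r₁ × ZMod r₂) : e ∈ twoOrbit e := ⟨0, by simp⟩

theorem isRestrictedRepresentatives_singleton (e : ZMod r₁ × ZMod r₂) :
    IsRestrictedRepresentatives (twoOrbit e) {e} := by
  refine ⟨by simpa using mem_twoOrbit_self e, fun d hd => ⟨e, by simpa using hd, by simp⟩, ?_⟩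
  rintro _ ⟨_, ⟨i, rfl⟩, rfl⟩
  exact ⟨e.1, ⟨by simp, i, by simp⟩, by simp⟩

theorem mem_twoOrbit_symm {m : ℕ} (hm : 0 < m) (h₁ : (2 : ZMod r₁) ^ m = 1)
    (h₂ : (2 : ZMod r₂) ^ m = 1) {d e : ZMod r₁ × ZMod r₂} (h : d ∈ twoOrbit e) :
    e ∈ twoOrbit d := by
  obtain ⟨i, rfl⟩ := h
  have hi : i + i * (m - 1) = m * i := by
    obtain ⟨k, rfl⟩ := Nat.exists_eq_succ_of_ne_zero hm.ne'
    simp only [Nat.succ_eq_add_one, Nat.add_sub_cancel]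
    ring
  refine ⟨i * (m - 1), ?_⟩
  ext
  · change e.1 * 2 ^ i * 2 ^ (i * (m - 1)) = e.1
    rw [mul_assoc, ← pow_add, hi, pow_mul, h₁, one_pow, mul_one]
  · change e.2 * 2 ^ i * 2 ^ (i * (m - 1)) = e.2
    rw [mul_assoc, ← pow_add, hi, pow_mul, h₂, one_pow, mul_one]

/-- A single orbit has exactly one representative. -/
theorem IsRestrictedRepresentatives.eq_singleton {m : ℕ} (hm : 0 < m)
    (h₁ : (2 : ZMod r₁) ^ m = 1) (h₂ : (2 : ZMod r₂) ^ m = 1) {e : ZMod r₁ × ZMod r₂}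
    {R : Finset (ZMod r₁ × ZMod r₂)} (hR : IsRestrictedRepresentatives (twoOrbit e) R) :
    ∃ d ∈ twoOrbit e, R = {d} := by
  obtain ⟨hsub, huniq, -⟩ := hR
  obtain ⟨d, ⟨hd, -⟩, hd'⟩ := huniq e (mem_twoOrbit_self e)
  exact ⟨d, hsub hd, Finset.eq_singleton_iff_unique_mem.2
    ⟨hd, fun c hc => hd' c ⟨hc, mem_twoOrbit_symm hm h₁ h₂ (hsub hc)⟩⟩⟩

/-- With one representative there is one positive step: `f₁ = m(d)`, `g₁ = m(d₁)`, `f₂ = 0`. -/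
theorem Gam_singleton (d : ZMod r₁ × ZMod r₂) :
    Gam {d} = rectangle r₁ r₂ (mFirst d.1) (mPair d) := by
  have hM : MSum {d} d.1 = mPair d := by simp [MSum, Finset.sum_filter]
  have h0 : fSeq {d} 0 = mPair d := by simp [fSeq, hM]
  have hs : ∀ j, fSeq {d} (j + 1) = 0 := by
    intro j
    induction j with
    | zero => simp [fSeq, hM]
    | succ j ih => rw [fSeq, ih]; simp
  have hg : gSeq {d} 0 = mFirst d.1 := by simp [gSeq, h0, hM, Finset.sum_filter]
  ext i
  constructor
  · rintro ⟨_ | j, -, h2, h3⟩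
    · exact ⟨hg ▸ h3, h0 ▸ h2⟩
    · rw [hs] at h2
      exact absurd h2 (Nat.not_lt_zero _)
  · rintro ⟨h1, h2⟩
    exact ⟨0, by rw [hs]; exact Nat.zero_le _, h0.symm ▸ h2, hg.symm ▸ h1⟩

theorem isUnit_of_generator {n : ℕ} [NeZero n] (T : ZMod n ≃+ ZMod r₁ × ZMod r₂) :
    IsUnit (T 1).1 ∧ IsUnit (T 1).2 := by
  have h : (T.symm 1).val • T 1 = 1 := by
    rw [← map_nsmul, nsmul_one, ZMod.natCast_zmod_val, T.apply_symm_apply]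
  have h1 := congrArg Prod.fst h
  have h2 := congrArg Prod.snd h
  simp only [nsmul_eq_mul, Prod.fst_one, Prod.snd_one] at h1 h2
  exact ⟨.of_mul_eq_one_right _ h1, .of_mul_eq_one_right _ h2⟩

theorem image_range_two_pow {n : ℕ} (T : ZMod n ≃+ ZMod r₁ × ZMod r₂) :
    T '' (Set.range fun j : ℕ => (2 : ZMod n) ^ j) = twoOrbit (T 1) := by
  rw [← Set.range_comp]
  refine congrArg Set.range (funext fun j => ?_)
  have h : (2 : ZMod n) ^ j = (2 ^ j : ℕ) • 1 := by simp
  rw [Function.comp_apply, h, map_nsmul]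
  ext <;> simp [mul_comm]

theorem Gam_eq_rectangle {m : ℕ} (hm : 0 < m) (hn : 2 ^ m - 1 = r₁ * r₂) (hodd₁ : Odd r₁)
    (hodd₂ : Odd r₂) (hcop : Nat.Coprime r₁ r₂) (hdvd : orderOf (2 : ZMod r₁) ∣ m)
    {e : ZMod r₁ × ZMod r₂} (he₁ : IsUnit e.1) (he₂ : IsUnit e.2)
    {R : Finset (ZMod r₁ × ZMod r₂)} (hR : IsRestrictedRepresentatives (twoOrbit e) R) :
    Gam R = rectangle r₁ r₂ (orderOf (2 : ZMod r₁)) (m / orderOf (2 : ZMod r₁)) := by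
  have h₁ : (2 : ZMod r₁) ^ m = 1 := (two_pow_eq_one_iff r₁ m).2 (hn ▸ Nat.dvd_mul_right _ _)
  have h₂ : (2 : ZMod r₂) ^ m = 1 := (two_pow_eq_one_iff r₂ m).2 (hn ▸ Nat.dvd_mul_left _ _)
  obtain ⟨_, ⟨i, rfl⟩, rfl⟩ := hR.eq_singleton hm h₁ h₂
  have hF : mFirst (e.1 * 2 ^ i) = orderOf (2 : ZMod r₁) :=
    ncard_cyclotomicCoset 1 (he₁.mul ((isUnit_two hodd₁).pow i)) (isUnit_two hodd₁) (by simp)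
  rw [Gam_singleton, mPair]
  simp only
  rw [hF, ncard_cyclotomicCoset _ (he₂.mul ((isUnit_two hodd₂).pow i))
    ((isUnit_two hodd₂).pow _) rfl, orderOf_two_pow hn hcop (Nat.pos_of_dvd_of_pos hdvd hm) hdvd]

end RMCode

theorem mainTheorem2 {m r₁ r₂ : ℕ} (hn : 2 ^ m - 1 = r₁ * r₂)
    (hodd₁ : Odd r₁) (hodd₂ : Odd r₂) (hcop : Nat.Coprime r₁ r₂)
    (hr₁ : 1 < r₁) (hr₂ : 1 < r₂)
    {K : Type*} [Field K] [Algebra (ZMod 2) K] (hK : Nat.card K = 2 ^ m)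
    (α : K) (hα : IsPrimitiveRoot α (2 ^ m - 1))
    (T : ZMod (2 ^ m - 1) ≃+ ZMod r₁ × ZMod r₂)
    (a : ℕ) (ha : a = orderOf (2 : ZMod r₁)) :
    a ∣ m ∧
    (∀ β₁ β₂ : K, IsPrimitiveRoot β₁ r₁ → IsPrimitiveRoot β₂ r₂ →
      ∀ C : Ideal (RMCode.BinAlg (ZMod r₁ × ZMod r₂)),
        RMCode.abelianDefiningSet β₁ β₂ C =
          T '' RMCode.cyclicDefiningSet α (RMCode.puncturedReedMuller α (m - 2) m) →
        (∃ R, RMCode.IsRestrictedRepresentatives (RMCode.abelianDefiningSet β₁ β₂ C) R) ∧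
        ∀ R, RMCode.IsRestrictedRepresentatives (RMCode.abelianDefiningSet β₁ β₂ C) R →
          RMCode.Gam R = RMCode.rectangle r₁ r₂ a (m / a)) ∧
    RMCode.IsCheckPositions (RMCode.puncturedReedMuller α (m - 2) m)
      (T ⁻¹' RMCode.rectangle r₁ r₂ a (m / a)) ∧
    RMCode.IsInformationSet (RMCode.reedMuller K 1 m)
      (insert 0 {g | ∃ i ∈ T ⁻¹' RMCode.rectangle r₁ r₂ a (m / a), g = α ^ i.val}) ∧
    RMCode.IsInformationSet (RMCode.reedMuller K (m - 2) m)
      {g | ∃ i ∉ T ⁻¹' RMCode.rectangle r₁ r₂ a (m / a), g = α ^ i.val} := by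
  subst ha
  have hprod : 2 * 2 ≤ r₁ * r₂ := Nat.mul_le_mul hr₁ hr₂
  have hm : 2 ≤ m := by
    by_contra h
    have := Nat.pow_le_pow_right (n := 2) (by norm_num) (show m ≤ 1 by omega)
    omega
  have : NeZero (2 ^ m - 1) := ⟨by omega⟩
  have : NeZero r₁ := ⟨by omega⟩
  have : NeZero r₂ := ⟨by omega⟩
  have : Finite K := Nat.finite_of_card_ne_zero (by rw [hK]; positivity)
  have hK' : Nat.card K = 2 ^ m - 1 + 1 := by omega
  have hrank : Module.finrank (ZMod 2) K = m := by
    have h := Module.natCard_eq_pow_finrank (K := ZMod 2) (V := K)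
    rw [hK, Nat.card_zmod] at h
    exact (Nat.pow_right_injective le_rfl h).symm
  have hbasis := RMCode.exists_basis_rectangle hα hK' T hodd₁
  rw [hrank] at hbasis
  obtain ⟨hdvd, b, hb⟩ := hbasis
  have hcheck := RMCode.isCheckPositions_of_basis b hm hα hK' hb
  refine ⟨hdvd, fun β₁ β₂ _ _ C hC => ?_, hcheck,
    RMCode.isInformationSet_reedMuller_one b hm hK hb,
    RMCode.isInformationSet_reedMuller_sub_two hm hα hK' hcheck⟩
  rw [hC, RMCode.cyclicDefiningSet_puncturedReedMuller hm hα hK' hrank,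
    RMCode.image_range_two_pow]
  obtain ⟨hu₁, hu₂⟩ := RMCode.isUnit_of_generator T
  exact ⟨⟨_, RMCode.isRestrictedRepresentatives_singleton _⟩, fun R hR =>
    RMCode.Gam_eq_rectangle (by omega) hn hodd₁ hodd₂ hcop hdvd hu₁ hu₂ hR⟩
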